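/- Let $a<b$ be real and $1<\alpha<2$. Let $AC^2[a,b]$ be the set of $u\in C^1[a,b]$ whose derivative $u'$ is absolutely continuous on $[a,b]$. For $g:[a,b]\to\mathbb R$ and $\beta=\alpha-1\in(0,1)$ put $$T^a_\beta g(t)=\lim_{\varepsilon\to0}\frac{g\bigl(t+\varepsilon(t-a)^{1-\beta}\bigr)-g(t)}{\varepsilon}\quad(a<t\le b)$$ when this limit exists (with $\varepsilon\neq 0$ such that the argument lies in $[a,b]$, so that the limit is one-sided at $t=b$), and $T^a_\beta g(a)=\lim_{t\to a^+}T^a_\beta g(t)$ when $T^a_\beta g$ exists on $(a,b)$ and this limit exists. The conformable derivative of order $\alpha$ of a differentiable function $u$ on $[a,b]$ is $T^a_\alpha u(t)=T^a_{\alpha-1}u'(t)$, derivatives being one-sided at the endpoints. Let $f:[a,b]\times\mathbb R\to\mathbb R$ and consider the boundary value problem $$T^a_\alpha u(t)+f(t,u(t))=0,\quad a<t<b,\qquad u(a)=u(b)=0.\tag{P}$$ A function $\underline\sigma\in AC^2[a,b]$ is a lower solution of (P) if, for every $t\in[a,b]$, $T^a_\alpha\underline\sigma(t)$ exists and $T^a_\alpha\underline\sigma(t)+f(t,\underline\sigma(t))\ge0$,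 and if $\underline\sigma(a)\le0$ and $\underline\sigma(b)\le0$. A function $\overline\sigma\in AC^2[a,b]$ is an upper solution of (P) if, for every $t\in[a,b]$, $T^a_\alpha\overline\sigma(t)$ exists and $T^a_\alpha\overline\sigma(t)+f(t,\overline\sigma(t))\le0$, and if $\overline\sigma(a)\ge0$ and $\overline\sigma(b)\ge0$. Theorem. Let $\underline\sigma$ and $\overline\sigma$ be a lower and an upper solution of (P) with $\underline\sigma\le\overline\sigma$ on $[a,b]$, and assume that $f$ is continuous on $E=\{(t,x)\in[a,b]\times\mathbb R:\underline\sigma(t)\le x\le\overline\sigma(t)\}$. Then (P) has at least one solution $u\in AC^2[a,b]$ (in particular $T^a_\alpha u(t)$ exists for every $t\in(a,b)$) such that $\underline\sigma(t)\le u(t)\le\overline\sigma(t)$ for all $t\in[a,b]$. -/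

import Mathlib

open Set Filter Topology

/-- The space `AC²[a,b]`: functions of class `C¹` on `[a,b]` whose derivative (one-sided at the
endpoints) is absolutely continuous on `[a,b]`. Only the values on `[a,b]` matter. -/
def AC2 (a b : ℝ) : Set (ℝ → ℝ) :=
  {u | ContDiffOn ℝ 1 u (Icc a b) ∧ AbsolutelyContinuousOnInterval (derivWithin u (Icc a b)) a b}

/-- For `0 < β < 1`, `a < t ≤ b` and `g` a function on `[a,b]`: the limit
`lim_{ε → 0} (g (t + ε (t - a) ^ (1 - β)) - g t) / ε` exists and equals `d`, where `ε ≠ 0` ranges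
over the numbers for which the argument of `g` stays in the domain `[a,b]` (at `t < b` this is the
ordinary two-sided limit, at `t = b` the one-sided one). -/
def HasConformableLimit (β a b : ℝ) (g : ℝ → ℝ) (t d : ℝ) : Prop :=
  Tendsto (fun ε : ℝ => (g (t + ε * (t - a) ^ (1 - β)) - g t) / ε)
    (𝓝[{ε : ℝ | ε ≠ 0 ∧ t + ε * (t - a) ^ (1 - β) ∈ Icc a b}] 0) (𝓝 d)

/-- For `0 < β < 1`: the function `g` on `[a,b]` has at `t` a conformable derivative of order `β`
(based at `a`), with value `d`. For `a < t` it is given by the limit above; at `t = a` it is the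
limit as `s → a⁺` of the conformable derivatives at `s`, provided these exist on `(a,b)`. -/
def HasConformableDerivLow (β a b : ℝ) (g : ℝ → ℝ) (t d : ℝ) : Prop :=
  (a < t ∧ t ≤ b ∧ HasConformableLimit β a b g t d) ∨
  (t = a ∧ ∃ D : ℝ → ℝ, (∀ s ∈ Ioo a b, HasConformableLimit β a b g s (D s)) ∧
    Tendsto D (𝓝[>] a) (𝓝 d))

/-- For `1 < α < 2`: the function `u` on `[a,b]` has at `t` the conformable derivative
`T_α^a u(t) = d`, that is, `u` is differentiable and `T_{α-1}^a u'(t) = d`. -/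
def HasConformableDeriv (α a b : ℝ) (u : ℝ → ℝ) (t d : ℝ) : Prop :=
  DifferentiableOn ℝ u (Icc a b) ∧
    HasConformableDerivLow (α - 1) a b (derivWithin u (Icc a b)) t d

/-- `u` solves `T_α^a u(t) + f(t,u(t)) = 0` for `a < t < b`, with `u(a) = u(b) = 0`. -/
structure IsSolution (α a b : ℝ) (f : ℝ → ℝ → ℝ) (u : ℝ → ℝ) : Prop where
  eqn : ∀ t ∈ Ioo a b, ∃ d, HasConformableDeriv α a b u t d ∧ d + f t (u t) = 0
  left : u a = 0
  right : u b = 0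

/-- Lower solution of the boundary value problem. -/
structure IsLowerSolution (α a b : ℝ) (f : ℝ → ℝ → ℝ) (σ : ℝ → ℝ) : Prop where
  mem : σ ∈ AC2 a b
  ineq : ∀ t ∈ Icc a b, ∃ d, HasConformableDeriv α a b σ t d ∧ 0 ≤ d + f t (σ t)
  left : σ a ≤ 0
  right : σ b ≤ 0

/-- Upper solution of the boundary value problem. -/
structure IsUpperSolution (α a b : ℝ) (f : ℝ → ℝ → ℝ) (σ : ℝ → ℝ) : Prop where
  mem : σ ∈ AC2 a b
  ineq : ∀ t ∈ Icc a b, ∃ d, HasConformableDeriv α a b σ t d ∧ d + f t (σ t) ≤ 0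
  left : 0 ≤ σ a
  right : 0 ≤ σ b

/-!
Put `w t = (t - a) ^ (α - 2)`. At an interior point the conformable derivative `T_α u` is just
`u'' / w` (`hasConformableDeriv_iff`), so the problem is the two-point problem `u'' = - w f(t, u)`,
`u a = u b = 0`, in which the weight `w` is singular at `a` but integrable because `1 < α`.

*Truncation.* Replace `f` by `F(t, x) = f(t, y)`, where `y` is the point of `[σl t, σu t]` nearest to
`x`. This function is continuous and bounded on the whole plane (`continuous_truncate`,
`exists_bound_truncate`).

*Existence for bounded `F`* (`exists_integral_solution`). No fixed point theorem is needed: the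
initial value problem with a delay, `u'' = - w F(t, u(t - δ))`, `u a = 0`, `u' a = s`, is solved by
finitely many substitutions, and its solution depends continuously on `s`. Since `F` is bounded, the
intermediate value theorem gives a slope `s`, bounded independently of `δ`, with `u b = 0`
(`exists_delayOp_fixed`). These solutions are uniformly Lipschitz, so by the Arzelà–Ascoli theorem
and dominated convergence a subsequence converges, as `δ → 0`, to a solution of the integral form of
the truncated problem. Such a solution lies in `AC²[a,b]` and solves the differential equation
(`regularity_of_integral_eq`).

*Comparison* (`le_of_second_deriv_le`). Where `u > σu`, the truncated nonlinearity equals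
`f(t, σu t)`, hence `u'' = - w f(t, σu) ≥ σu''`. Thus `u - σu` is convex wherever it is positive, and
it is nonpositive at `a` and `b`, so it is nowhere positive. The same argument applies to `σl - u`.
Therefore `σl ≤ u ≤ σu`, where `F` and `f` agree.
-/

/-! ### Solving the integral equation with a delay -/

/-- The right-hand side of the integral equation
`u t = s * (t - a) - ∫ r in a..t, (t - r) * (w r * F r (u r))`, with the argument of `u` delayed
by `δ`. The integral is written over the whole of `[a,b]`, with the kernel `max (t - r) 0`, so that
the formula makes sense for all real `t` and vanishes for `t ≤ a`. -/
noncomputable def delayOp (a b : ℝ) (w : ℝ → ℝ) (F : ℝ → ℝ → ℝ) (δ s : ℝ) (u : ℝ → ℝ) (t : ℝ) : ℝ :=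
  s * max (t - a) 0 - ∫ r in a..b, max (t - r) 0 * (w r * F r (u (r - δ)))

/-- Iterates of `delayOp`, starting at `0`. -/
noncomputable def delayIter (a b : ℝ) (w : ℝ → ℝ) (F : ℝ → ℝ → ℝ) (δ s : ℝ) (n : ℕ) : ℝ → ℝ :=
  (delayOp a b w F δ s)^[n] 0

lemma delayIter_succ (a b : ℝ) (w : ℝ → ℝ) (F : ℝ → ℝ → ℝ) (δ s : ℝ) (n : ℕ) :
    delayIter a b w F δ s (n + 1) = delayOp a b w F δ s (delayIter a b w F δ s n) :=
  Function.iterate_succ_apply' _ _ _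

section Delay

variable {a b M : ℝ} {w : ℝ → ℝ} {F : ℝ → ℝ → ℝ}

lemma intervalIntegrable_weight_mul (hw : IntervalIntegrable w MeasureTheory.volume a b)
    (hF : Continuous (Function.uncurry F)) {u : ℝ → ℝ} (hu : Continuous u) :
    IntervalIntegrable (fun r => w r * F r (u r)) MeasureTheory.volume a b :=
  hw.mul_continuousOn (hF.comp (continuous_id.prodMk hu)).continuousOn

lemma intervalIntegrable_kernel_mul (hw : IntervalIntegrable w MeasureTheory.volume a b)
    (hF : Continuous (Function.uncurry F)) {u : ℝ → ℝ} (hu : Continuous u) (t : ℝ) :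
    IntervalIntegrable (fun r => max (t - r) 0 * (w r * F r (u r))) MeasureTheory.volume a b :=
  (intervalIntegrable_weight_mul hw hF hu).continuousOn_mul (by fun_prop)

/-- Pointwise convergence is enough to pass to the limit in the integral operator. -/
lemma tendsto_kernel_integral {ι : Type*} {l : Filter ι} [l.IsCountablyGenerated] (hab : a ≤ b)
    (hw : IntervalIntegrable w MeasureTheory.volume a b)
    (hF : Continuous (Function.uncurry F)) (hM : ∀ t x, |F t x| ≤ M)
    {u : ι → ℝ → ℝ} {v : ℝ → ℝ} (hu : ∀ i, Continuous (u i))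
    (huv : ∀ r ∈ Icc a b, Tendsto (fun i => u i r) l (𝓝 (v r))) (t : ℝ) :
    Tendsto (fun i => ∫ r in a..b, max (t - r) 0 * (w r * F r (u i r))) l
      (𝓝 (∫ r in a..b, max (t - r) 0 * (w r * F r (v r)))) := by
  refine intervalIntegral.tendsto_integral_filter_of_dominated_convergence
    (fun r => |t - a| * (|w r| * M)) (Eventually.of_forall fun i => ?_)
    (Eventually.of_forall fun i => Eventually.of_forall fun r hr => ?_)
    ((hw.abs.mul_const M).const_mul _) (Eventually.of_forall fun r hr => ?_)
  · exact (intervalIntegrable_iff.1 (intervalIntegrable_kernel_mul hw hF (hu i) t)).aestronglyMeasurable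
  · rw [uIoc_of_le hab] at hr
    rw [Real.norm_eq_abs, abs_mul, abs_mul]
    have h1 : |max (t - r) 0| ≤ |t - a| := by
      rw [abs_of_nonneg (le_max_right _ _)]
      exact max_le ((by linarith [hr.1] : t - r ≤ t - a).trans (le_abs_self _)) (abs_nonneg _)
    gcongr
    exact hM _ _
  · rw [uIoc_of_le hab] at hr
    have h1 := (hF.tendsto (r, v r)).comp
      ((tendsto_const_nhds (x := r)).prodMk_nhds (huv r ⟨hr.1.le, hr.2⟩))
    exact (h1.const_mul (w r)).const_mul _

lemma abs_integral_weight_mul_le (hab : a ≤ b) (hw : IntervalIntegrable w MeasureTheory.volume a b)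
    (hM : ∀ t x, |F t x| ≤ M) {k : ℝ → ℝ} {C : ℝ} (hk : ∀ r ∈ Icc a b, |k r| ≤ C) (u : ℝ → ℝ) :
    |∫ r in a..b, k r * (w r * F r (u r))| ≤ C * (M * ∫ r in a..b, |w r|) := by
  have h : ∀ r ∈ Ioc a b, ‖k r * (w r * F r (u r))‖ ≤ C * (M * |w r|) := fun r hr => by
    have h1 := hk r ⟨hr.1.le, hr.2⟩
    have hC : 0 ≤ C := (abs_nonneg _).trans h1
    rw [Real.norm_eq_abs, abs_mul, abs_mul, mul_comm M]
    gcongr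
    exact hM _ _
  have := intervalIntegral.norm_integral_le_of_norm_le hab
    (Eventually.of_forall h) ((hw.abs.const_mul M).const_mul C)
  simpa using this

lemma lipschitz_delayOp (hab : a ≤ b) (hw : IntervalIntegrable w MeasureTheory.volume a b)
    (hF : Continuous (Function.uncurry F)) (hM : ∀ t x, |F t x| ≤ M)
    {u : ℝ → ℝ} (hu : Continuous u) (δ s : ℝ) :
    LipschitzWith (|s| + M * ∫ r in a..b, |w r|).toNNReal (delayOp a b w F δ s u) := by
  have hmax : ∀ x y c : ℝ, |max (x - c) 0 - max (y - c) 0| ≤ |x - y| := fun x y c => by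
    simpa using abs_max_sub_max_le_abs (x - c) (y - c) 0
  have hu' : Continuous fun r => u (r - δ) := by fun_prop
  refine LipschitzWith.of_dist_le_mul fun x y => ?_
  have hx := intervalIntegrable_kernel_mul hw hF hu' x
  have hy := intervalIntegrable_kernel_mul hw hF hu' y
  have h1 : delayOp a b w F δ s u x - delayOp a b w F δ s u y
      = s * (max (x - a) 0 - max (y - a) 0)
        - ∫ r in a..b, (max (x - r) 0 - max (y - r) 0) * (w r * F r (u (r - δ))) := by
    simp only [sub_mul, delayOp]
    rw [intervalIntegral.integral_sub hx hy]
    ring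
  have h2 := abs_integral_weight_mul_le hab hw hM (fun r _ => hmax x y r) (fun r => u (r - δ))
  have h3 : |s * (max (x - a) 0 - max (y - a) 0)| ≤ |s| * |x - y| := by
    rw [abs_mul]
    exact mul_le_mul_of_nonneg_left (hmax x y a) (abs_nonneg s)
  rw [Real.dist_eq, Real.dist_eq, h1]
  calc _ ≤ _ := abs_sub _ _
    _ ≤ |s| * |x - y| + |x - y| * (M * ∫ r in a..b, |w r|) := add_le_add h3 h2
    _ = (|s| + M * ∫ r in a..b, |w r|) * |x - y| := by ring
    _ ≤ _ := mul_le_mul_of_nonneg_right (Real.le_coe_toNNReal _) (abs_nonneg _)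

lemma continuous_delayIter (hab : a ≤ b) (hw : IntervalIntegrable w MeasureTheory.volume a b)
    (hF : Continuous (Function.uncurry F)) (hM : ∀ t x, |F t x| ≤ M) (δ s : ℝ) (n : ℕ) :
    Continuous (delayIter a b w F δ s n) := by
  induction n with
  | zero => exact continuous_zero
  | succ n ih =>
    rw [delayIter_succ]
    exact (lipschitz_delayOp hab hw hF hM ih δ s).continuous

lemma continuous_delayIter_slope (hab : a ≤ b) (hw : IntervalIntegrable w MeasureTheory.volume a b)
    (hF : Continuous (Function.uncurry F)) (hM : ∀ t x, |F t x| ≤ M) (δ : ℝ) (n : ℕ) (t : ℝ) :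
    Continuous fun s => delayIter a b w F δ s n t := by
  induction n generalizing t with
  | zero => exact continuous_const
  | succ n ih =>
    simp only [delayIter_succ, delayOp]
    refine (continuous_id.mul continuous_const).sub (continuous_iff_continuousAt.2 fun s₀ => ?_)
    exact tendsto_kernel_integral hab hw hF hM
      (u := fun s r => delayIter a b w F δ s n (r - δ))
      (fun s => (continuous_delayIter hab hw hF hM δ s n).comp (by fun_prop))
      (fun r _ => (ih (r - δ)).tendsto s₀) t

/-- The iterates become stationary, one step of length `δ` at a time. -/
lemma delayIter_succ_eq (hab : a ≤ b) (δ s : ℝ) (n : ℕ) {t : ℝ} (ht : t ≤ a + n * δ) :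
    delayIter a b w F δ s (n + 1) t = delayIter a b w F δ s n t := by
  induction n generalizing t with
  | zero =>
    have h0 : t ≤ a := by simpa using ht
    have h1 : ∫ r in a..b, max (t - r) 0 * (w r * F r ((0 : ℝ → ℝ) (r - δ))) = 0 := by
      rw [← intervalIntegral.integral_zero (a := a) (b := b) (μ := MeasureTheory.volume)]
      refine intervalIntegral.integral_congr fun r hr => ?_
      rw [uIcc_of_le hab] at hr
      simp [max_eq_right (by linarith [hr.1] : t - r ≤ 0)]
    rw [delayIter_succ]
    simp only [delayOp, delayIter, Function.iterate_zero, id]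
    rw [h1, max_eq_right (by linarith)]
    simp
  | succ n ih =>
    rw [delayIter_succ]
    conv_rhs => rw [delayIter_succ]
    simp only [delayOp]
    congr 1
    refine intervalIntegral.integral_congr fun r hr => ?_
    rcases le_or_gt t r with h | h
    · simp [max_eq_right (by linarith : t - r ≤ 0)]
    · push_cast at ht
      simp only [ih (by linarith : r - δ ≤ a + n * δ)]

/-- Shooting for the delayed equation: the value at `b` depends continuously on the slope `s`, and
it has the sign of `s` at `s = ± M ∫ |w|`. -/
lemma exists_delayOp_fixed (hab : a < b) (hw : IntervalIntegrable w MeasureTheory.volume a b)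
    (hF : Continuous (Function.uncurry F)) (hM : ∀ t x, |F t x| ≤ M) {δ : ℝ} (hδ : 0 < δ) :
    ∃ (s : ℝ) (u : ℝ → ℝ), s ∈ Icc (-(M * ∫ r in a..b, |w r|)) (M * ∫ r in a..b, |w r|) ∧
      LipschitzWith (M * (∫ r in a..b, |w r|) + M * ∫ r in a..b, |w r|).toNNReal u ∧
      u b = 0 ∧ ∀ t ≤ b, u t = delayOp a b w F δ s u t := by
  set C := M * ∫ r in a..b, |w r| with hC
  have hM0 : 0 ≤ M := (abs_nonneg _).trans (hM 0 0)
  have hC0 : 0 ≤ C :=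
    mul_nonneg hM0 (intervalIntegral.integral_nonneg hab.le fun r _ => abs_nonneg _)
  obtain ⟨n, hn⟩ := exists_nat_gt ((b - a) / δ)
  have hnb : b ≤ a + (n + 1 : ℕ) * δ := by
    rw [div_lt_iff₀ hδ] at hn
    push_cast
    linarith
  have hint : ∀ s : ℝ, |∫ r in a..b, max (b - r) 0 *
      (w r * F r (delayIter a b w F δ s n (r - δ)))| ≤ (b - a) * C := fun s =>
    abs_integral_weight_mul_le hab.le hw hM (fun r hr => by
      rw [abs_of_nonneg (le_max_right _ _)]
      exact max_le (by linarith [hr.1]) (by linarith)) _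
  have hval : ∀ s, delayIter a b w F δ s (n + 1) b = s * (b - a) - ∫ r in a..b, max (b - r) 0 *
      (w r * F r (delayIter a b w F δ s n (r - δ))) := fun s => by
    rw [delayIter_succ]
    simp only [delayOp]
    rw [max_eq_left (by linarith)]
  obtain ⟨s, hs, hs0⟩ : (0 : ℝ) ∈ (fun s => delayIter a b w F δ s (n + 1) b) '' Icc (-C) C := by
    refine intermediate_value_Icc (by linarith)
      (continuous_delayIter_slope hab.le hw hF hM δ (n + 1) b).continuousOn ⟨?_, ?_⟩
    · simp only [hval]
      linarith [neg_abs_le (∫ r in a..b, max (b - r) 0 *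
        (w r * F r (delayIter a b w F δ (-C) n (r - δ)))), hint (-C)]
    · simp only [hval]
      linarith [le_abs_self (∫ r in a..b, max (b - r) 0 *
        (w r * F r (delayIter a b w F δ C n (r - δ)))), hint C]
  refine ⟨s, delayIter a b w F δ s (n + 1), hs, ?_, hs0, fun t ht => ?_⟩
  · rw [delayIter_succ]
    refine (lipschitz_delayOp hab.le hw hF hM
      (continuous_delayIter hab.le hw hF hM δ s n) δ s).weaken (Real.toNNReal_le_toNNReal ?_)
    linarith [abs_le.2 hs]
  · rw [← delayIter_succ, delayIter_succ_eq hab.le δ s (n + 1) (ht.trans hnb)]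

end Delay

/-! ### Passing to the limit -/

/-- A sequential form of the Arzelà–Ascoli theorem for uniformly Lipschitz functions. -/
lemma exists_subseq_tendsto_of_lipschitz {a b C : ℝ} (hab : a ≤ b) {K : NNReal} {u : ℕ → ℝ → ℝ}
    (hu : ∀ n, LipschitzWith K (u n)) (hC : ∀ n, ∀ t ∈ Icc a b, |u n t| ≤ C) :
    ∃ (v : ℝ → ℝ) (φ : ℕ → ℕ), Continuous v ∧ StrictMono φ ∧
      ∀ t ∈ Icc a b, Tendsto (fun n => u (φ n) t) atTop (𝓝 (v t)) := by
  let U : ℕ → BoundedContinuousFunction (Icc a b) ℝ := fun n =>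
    BoundedContinuousFunction.mkOfCompact ⟨fun x => u n x, (hu n).continuous.comp continuous_subtype_val⟩
  have hU : ∀ n x, U n x = u n x := fun _ _ => rfl
  have hK : IsCompact (closure (range U)) := by
    refine BoundedContinuousFunction.arzela_ascoli (Icc (-C) C) isCompact_Icc (range U) ?_ ?_
    · rintro _ x ⟨n, rfl⟩
      rw [hU]
      exact abs_le.1 (hC n x x.2)
    · refine LipschitzWith.uniformEquicontinuous (K := K) _ ?_ |>.equicontinuous
      rintro ⟨_, n, rfl⟩
      exact LipschitzWith.of_dist_le_mul fun x y => (hu n).dist_le_mul x y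
  obtain ⟨v, -, φ, hφ, hv⟩ := hK.tendsto_subseq (x := U) fun n => subset_closure (mem_range_self n)
  refine ⟨IccExtend hab v, φ, v.continuous.Icc_extend', hφ, fun t ht => ?_⟩
  rw [IccExtend_of_mem hab v ht]
  exact (BoundedContinuousFunction.tendsto_iff_tendstoUniformly.1 hv).tendsto_at ⟨t, ht⟩

/-- Existence for the integral form of `u'' = - w F(t, u)`, `u a = u b = 0`, with `F` continuous and
bounded: delayed solutions have a cluster point as the delay tends to `0`. -/
theorem exists_integral_solution {a b M : ℝ} {w : ℝ → ℝ} {F : ℝ → ℝ → ℝ} (hab : a < b)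
    (hw : IntervalIntegrable w MeasureTheory.volume a b)
    (hF : Continuous (Function.uncurry F)) (hM : ∀ t x, |F t x| ≤ M) :
    ∃ (s : ℝ) (u : ℝ → ℝ), Continuous u ∧ u b = 0 ∧ ∀ t ∈ Icc a b,
      u t = s * (t - a) - ∫ r in a..b, max (t - r) 0 * (w r * F r (u r)) := by
  set C := M * ∫ r in a..b, |w r|
  have hδ : ∀ n : ℕ, (0 : ℝ) < 1 / (n + 1) := fun n => Nat.one_div_pos_of_nat
  choose s u hs hu hub hfix using fun n => exists_delayOp_fixed hab hw hF hM (hδ n)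
  set K := (C + C).toNNReal
  have hbd : ∀ n, ∀ t ∈ Icc a b, |u n t| ≤ K * (b - a) := fun n t ht => by
    have h := (hu n).dist_le_mul t b
    have htb : |t - b| ≤ b - a := abs_le.2 ⟨by linarith [ht.1], by linarith [ht.2]⟩
    rw [Real.dist_eq, hub, sub_zero, Real.dist_eq] at h
    exact h.trans (mul_le_mul_of_nonneg_left htb K.2)
  obtain ⟨v, φ, hv, hφ, huv⟩ := exists_subseq_tendsto_of_lipschitz hab.le hu hbd
  obtain ⟨S, -, ψ, hψ, hS⟩ := isCompact_Icc.tendsto_subseq (x := fun n => s (φ n)) fun n => hs (φ n)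
  have hφψ : Tendsto (fun n => φ (ψ n)) atTop atTop := hφ.tendsto_atTop.comp hψ.tendsto_atTop
  have hlim : ∀ t ∈ Icc a b, Tendsto (fun n => u (φ (ψ n)) t) atTop (𝓝 (v t)) :=
    fun t ht => (huv t ht).comp hψ.tendsto_atTop
  -- the shift of the argument is harmless because the functions are uniformly Lipschitz
  have hshift : ∀ t ∈ Icc a b,
      Tendsto (fun n => u (φ (ψ n)) (t - 1 / ((φ (ψ n) : ℕ) + 1))) atTop (𝓝 (v t)) := fun t ht => by
    have h0 : Tendsto (fun n => (K : ℝ) * (1 / ((φ (ψ n) : ℕ) + 1 : ℝ))) atTop (𝓝 0) := by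
      simpa using (tendsto_one_div_add_atTop_nhds_zero_nat.comp hφψ).const_mul (K : ℝ)
    refine tendsto_of_tendsto_of_dist (hlim t ht)
      (squeeze_zero (fun _ => dist_nonneg) (fun n => ?_) h0)
    refine ((hu _).dist_le_mul _ _).trans_eq ?_
    rw [Real.dist_eq, sub_sub_cancel, abs_of_pos (hδ _)]
  refine ⟨S, v, hv, ?_, fun t ht => ?_⟩
  · refine tendsto_nhds_unique (hlim b (right_mem_Icc.2 hab.le)) ?_
    simp [hub]
  · refine tendsto_nhds_unique (hlim t ht) ?_
    have h1 := tendsto_kernel_integral hab.le hw hF hM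
      (u := fun n r => u (φ (ψ n)) (r - 1 / ((φ (ψ n) : ℕ) + 1)))
      (fun n => (hu _).continuous.comp (by fun_prop)) hshift t
    refine ((hS.mul_const (t - a)).sub h1).congr fun n => ?_
    rw [hfix _ t ht.2, delayOp, max_eq_left (by linarith [ht.1])]
    rfl

/-! ### Regularity of solutions of the integral equation -/

/-- Integration by parts turns the kernel `(t - r)⁺` into an iterated integral. -/
lemma integral_kernel_eq {a b t : ℝ} {h : ℝ → ℝ} (ht : t ∈ Icc a b)
    (hi : IntervalIntegrable h MeasureTheory.volume a b) (hc : ContinuousOn h (Ioc a b)) :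
    ∫ r in a..b, max (t - r) 0 * h r = ∫ τ in a..t, ∫ r in a..τ, h r := by
  have hab : a ≤ b := ht.1.trans ht.2
  have hia : IntervalIntegrable h MeasureTheory.volume a t := hi.mono_set (by
    rw [uIcc_of_le hab, uIcc_of_le ht.1]; exact Icc_subset_Icc_right ht.2)
  have hib : IntervalIntegrable h MeasureTheory.volume t b := hi.mono_set (by
    rw [uIcc_of_le hab, uIcc_of_le ht.2]; exact Icc_subset_Icc_left ht.1)
  have hk : Continuous fun r => max (t - r) 0 := by fun_prop
  rw [← intervalIntegral.integral_add_adjacent_intervals (hia.continuousOn_mul hk.continuousOn)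
    (hib.continuousOn_mul hk.continuousOn)]
  have h1 : ∫ r in t..b, max (t - r) 0 * h r = 0 := by
    rw [← intervalIntegral.integral_zero (a := t) (b := b) (μ := MeasureTheory.volume)]
    refine intervalIntegral.integral_congr fun r hr => ?_
    rw [uIcc_of_le ht.2] at hr
    simp [max_eq_right (by linarith [hr.1] : t - r ≤ 0)]
  have h2 : ∫ r in a..t, max (t - r) 0 * h r = ∫ r in a..t, h r * (t - r) := by
    refine intervalIntegral.integral_congr fun r hr => ?_
    rw [uIcc_of_le ht.1] at hr
    simp [max_eq_left (by linarith [hr.2] : 0 ≤ t - r), mul_comm]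
  have h3 := intervalIntegral.integral_mul_deriv_eq_deriv_mul_of_hasDerivAt (a := a) (b := t)
    (u := fun τ => ∫ r in a..τ, h r) (u' := h) (v := fun τ => τ - t) (v' := fun _ => 1)
    (intervalIntegral.continuousOn_primitive_interval' hia left_mem_uIcc) (by fun_prop)
    (fun x hx => by
      rw [min_eq_left ht.1, max_eq_right ht.1] at hx
      have hn : Ioc a b ∈ 𝓝 x := Ioc_mem_nhds hx.1 (hx.2.trans_le ht.2)
      refine intervalIntegral.integral_hasDerivAt_right (hia.mono_set ?_) ?_ (hc.continuousAt hn)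
      · rw [uIcc_of_le ht.1, uIcc_of_le hx.1.le]; exact Icc_subset_Icc_right hx.2.le
      · exact (hc.mono Ioo_subset_Ioc_self).stronglyMeasurableAtFilter isOpen_Ioo x ⟨hx.1, hx.2.trans_le ht.2⟩)
    (fun x _ => (hasDerivAt_id x).sub_const t) hia (by simp)
  have h4 : ∫ r in a..t, h r * (r - t) = -∫ r in a..t, h r * (t - r) := by
    rw [← intervalIntegral.integral_neg]
    congr 1; ext r; ring
  simp only [mul_one, sub_self, mul_zero, intervalIntegral.integral_same, zero_mul, zero_sub] at h3
  rw [h1, h2, add_zero, h3, h4, neg_neg]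

/-- A solution of the integral equation is in `AC²[a,b]`, and satisfies the differential equation on
`(a,b)`. -/
lemma regularity_of_integral_eq {a b s : ℝ} (hab : a < b) {u h : ℝ → ℝ}
    (hi : IntervalIntegrable h MeasureTheory.volume a b) (hc : ContinuousOn h (Ioc a b))
    (hu : ∀ t ∈ Icc a b, u t = s * (t - a) - ∫ r in a..b, max (t - r) 0 * h r) :
    u ∈ AC2 a b ∧ ∀ t ∈ Ioo a b, HasDerivAt (derivWithin u (Icc a b)) (-h t) t := by
  have hu' : ∀ t ∈ Icc a b, u t = s * (t - a) - ∫ τ in a..t, ∫ r in a..τ, h r := fun t ht => by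
    rw [hu t ht, integral_kernel_eq ht hi hc]
  have hG : ContinuousOn (fun τ => ∫ r in a..τ, h r) (Icc a b) := by
    have := intervalIntegral.continuousOn_primitive_interval' hi left_mem_uIcc
    rwa [uIcc_of_le hab.le] at this
  have hd : ∀ t ∈ Icc a b, HasDerivWithinAt u (s - ∫ r in a..t, h r) (Icc a b) t := fun t ht => by
    have : Fact (t ∈ Icc a b) := ⟨ht⟩
    have h1 : HasDerivWithinAt (fun x => ∫ τ in a..x, ∫ r in a..τ, h r) (∫ r in a..t, h r)
        (Icc a b) t := by
      refine intervalIntegral.integral_hasDerivWithinAt_right ?_ ?_ (hG t ht)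
      · refine (hG.mono ?_).intervalIntegrable
        rw [uIcc_of_le ht.1]; exact Icc_subset_Icc_right ht.2
      · exact hG.stronglyMeasurableAtFilter_nhdsWithin measurableSet_Icc t
    have h2 : HasDerivWithinAt (fun x => s * (x - a)) s (Icc a b) t := by
      simpa using (((hasDerivAt_id t).sub_const a).const_mul s).hasDerivWithinAt
    exact (h2.sub h1).congr hu' (hu' t ht)
  have hdw : ∀ t ∈ Icc a b, derivWithin u (Icc a b) t = s - ∫ r in a..t, h r := fun t ht =>
    (hd t ht).derivWithin (uniqueDiffOn_Icc hab t ht)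
  refine ⟨⟨?_, ?_⟩, fun t ht => ?_⟩
  · rw [show (1 : WithTop ℕ∞) = 0 + 1 from rfl, contDiffOn_succ_iff_derivWithin (uniqueDiffOn_Icc hab)]
    refine ⟨fun t ht => (hd t ht).differentiableWithinAt, by simp, ?_⟩
    rw [contDiffOn_zero]
    exact (continuousOn_const.sub hG).congr hdw
  · have h1 : AbsolutelyContinuousOnInterval (fun t => s - ∫ r in a..t, h r) a b :=
      ((LipschitzWith.const s).lipschitzOnWith.absolutelyContinuousOnInterval).sub
        (hi.absolutelyContinuousOnInterval_intervalIntegral left_mem_uIcc)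
    rw [absolutelyContinuousOnInterval_iff] at h1 ⊢
    intro ε hε
    obtain ⟨δ, hδ, h2⟩ := h1 ε hε
    refine ⟨δ, hδ, fun E hE hlt => (Finset.sum_congr rfl fun i hi => ?_).trans_lt (h2 E hE hlt)⟩
    have h3 := hE.1 i hi
    rw [uIcc_of_le hab.le] at h3
    rw [hdw _ h3.1, hdw _ h3.2]
  · have h1 : HasDerivAt (fun x => ∫ r in a..x, h r) (h t) t := by
      refine intervalIntegral.integral_hasDerivAt_right (hi.mono_set ?_) ?_
        (hc.continuousAt (Ioc_mem_nhds ht.1 ht.2))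
      · rw [uIcc_of_le hab.le, uIcc_of_le ht.1.le]; exact Icc_subset_Icc_right ht.2.le
      · exact (hc.mono Ioo_subset_Ioc_self).stronglyMeasurableAtFilter isOpen_Ioo t ht
    refine (h1.const_sub s).congr_of_eventuallyEq ?_
    filter_upwards [Icc_mem_nhds ht.1 ht.2] with x hx using hdw x hx

/-! ### Conformable derivatives in the interior -/

/-- At an interior point, a conformable derivative of order `β` is an ordinary derivative, up to the
factor `(t - a) ^ (1 - β)`. -/
lemma hasConformableLimit_iff {β a b t d : ℝ} {g : ℝ → ℝ} (ht : t ∈ Ioo a b) :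
    HasConformableLimit β a b g t d ↔ HasDerivAt g (d / (t - a) ^ (1 - β)) t := by
  have hc : 0 < (t - a) ^ (1 - β) := Real.rpow_pos_of_pos (by linarith [ht.1]) _
  rw [HasConformableLimit]
  set c := (t - a) ^ (1 - β)
  have hset : 𝓝[{ε : ℝ | ε ≠ 0 ∧ t + ε * c ∈ Icc a b}] 0 = 𝓝[≠] 0 := by
    refine nhdsWithin_eq_nhdsWithin (s := (fun ε : ℝ => t + ε * c) ⁻¹' Ioo a b) (by simpa using ht)
      (isOpen_Ioo.preimage (by fun_prop)) ?_
    ext ε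
    simp only [mem_inter_iff, mem_ofPred_eq, mem_preimage, mem_compl_iff, mem_singleton_iff]
    exact ⟨fun h => ⟨h.1.1, h.2⟩, fun h => ⟨⟨h.1, Ioo_subset_Icc_self h.2⟩, h.2⟩⟩
  have hscale : HasDerivAt (fun ε : ℝ => g (t + ε * c)) d 0 ↔ HasDerivAt g (d / c) t := by
    constructor
    · intro h
      have h0 : HasDerivAt (fun x : ℝ => (x - t) / c) (1 / c) t :=
        ((hasDerivAt_id t).sub_const t).div_const c
      have h1 := HasDerivAt.comp t (h₂ := fun ε : ℝ => g (t + ε * c)) (h₂' := d)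
        (by simpa using h) h0
      rw [mul_one_div] at h1
      refine h1.congr_of_eventuallyEq (Eventually.of_forall fun x => ?_)
      simp only [Function.comp]
      rw [div_mul_cancel₀ _ hc.ne', add_sub_cancel]
    · intro h
      have h0 : HasDerivAt (fun ε : ℝ => t + ε * c) c 0 := by
        simpa using ((hasDerivAt_id (0 : ℝ)).mul_const c).const_add t
      have h1 := HasDerivAt.comp (0 : ℝ) (h₂ := g) (h₂' := d / c) (by simpa using h) h0
      rwa [div_mul_cancel₀ _ hc.ne'] at h1
  rw [hset, ← hscale, hasDerivAt_iff_tendsto_slope_zero]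
  simp [div_eq_inv_mul]

/-- In the interior, the conformable derivative of order `α` is `(t - a) ^ (2 - α) u''(t)`. -/
lemma hasConformableDeriv_iff {α a b t d : ℝ} {u : ℝ → ℝ} (ht : t ∈ Ioo a b) :
    HasConformableDeriv α a b u t d ↔ DifferentiableOn ℝ u (Icc a b) ∧
      HasDerivAt (derivWithin u (Icc a b)) ((t - a) ^ (α - 2) * d) t := by
  have h : (t - a) ^ (α - 2) * d = d / (t - a) ^ (1 - (α - 1)) := by
    rw [div_eq_inv_mul, ← Real.rpow_neg (by linarith [ht.1])]
    congr 2
    ring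
  rw [HasConformableDeriv, HasConformableDerivLow, h, ← hasConformableLimit_iff ht]
  refine and_congr_right fun _ => ⟨?_, fun h => Or.inl ⟨ht.1, ht.2.le, h⟩⟩
  rintro (h | h)
  · exact h.2.2
  · exact absurd h.1 ht.1.ne'

lemma AC2.hasDerivAt {a b t : ℝ} {u : ℝ → ℝ} (hu : u ∈ AC2 a b) (ht : t ∈ Ioo a b) :
    HasDerivAt u (derivWithin u (Icc a b) t) t :=
  ((hu.1.differentiableOn one_ne_zero) t (Ioo_subset_Icc_self ht)).hasDerivWithinAt.hasDerivAt
    (Icc_mem_nhds ht.1 ht.2)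

/-! ### Comparison -/

/-- A function which is convex wherever it is positive, and is nonpositive at both ends, is
nonpositive: to the right of a positive interior maximum it would increase as long as it stays
positive. -/
lemma nonpos_of_convex_where_pos {a b : ℝ} {v v' v'' : ℝ → ℝ} (hc : ContinuousOn v (Icc a b))
    (hv : ∀ t ∈ Ioo a b, HasDerivAt v (v' t) t) (hv' : ∀ t ∈ Ioo a b, HasDerivAt v' (v'' t) t)
    (hpos : ∀ t ∈ Ioo a b, 0 < v t → 0 ≤ v'' t) (ha : v a ≤ 0) (hb : v b ≤ 0) :
    ∀ t ∈ Icc a b, v t ≤ 0 := by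
  by_contra! hcon
  obtain ⟨t₁, ht₁, hvt₁⟩ := hcon
  obtain ⟨m, hm, hmax⟩ := isCompact_Icc.exists_isMaxOn ⟨t₁, ht₁⟩ hc
  have hvm : 0 < v m := hvt₁.trans_le (hmax ht₁)
  have hm' : m ∈ Ioo a b :=
    ⟨hm.1.lt_of_ne (by rintro rfl; linarith), hm.2.lt_of_ne (by rintro rfl; linarith)⟩
  have hdm : v' m = 0 :=
    (hmax.isLocalMax (Icc_mem_nhds hm'.1 hm'.2)).hasDerivAt_eq_zero (hv m hm')
  -- the first point `q` after `m` at which `v` is nonpositive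
  have hcomp : IsCompact (Icc m b ∩ v ⁻¹' Iic 0) := by
    refine isCompact_Icc.of_isClosed_subset ?_ inter_subset_left
    exact (hc.mono (Icc_subset_Icc_left hm.1)).preimage_isClosed_of_isClosed isClosed_Icc isClosed_Iic
  obtain ⟨q, ⟨hq, hvq⟩, hqmin⟩ := hcomp.exists_isLeast ⟨b, right_mem_Icc.2 hm.2, hb⟩
  have hmq : m < q := hq.1.lt_of_ne (by rintro rfl; exact absurd hvq (not_le.2 hvm))
  have hposq : ∀ t ∈ Ico m q, 0 < v t := fun t ht => by
    by_contra! h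
    exact absurd (hqmin ⟨⟨ht.1, ht.2.le.trans hq.2⟩, h⟩) (not_le.2 ht.2)
  have hsub : ∀ t ∈ Ico m q, t ∈ Ioo a b := fun t ht =>
    ⟨hm'.1.trans_le ht.1, ht.2.trans_le hq.2⟩
  have hmono' : MonotoneOn v' (Ico m q) := by
    refine monotoneOn_of_deriv_nonneg (convex_Ico m q)
      (fun t ht => (hv' t (hsub t ht)).continuousAt.continuousWithinAt)
      (fun t ht => ?_) (fun t ht => ?_)
    · exact (hv' t (hsub t (interior_subset ht))).differentiableAt.differentiableWithinAt
    · rw [(hv' t (hsub t (interior_subset ht))).deriv]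
      exact hpos t (hsub t (interior_subset ht)) (hposq t (interior_subset ht))
  have hmono : MonotoneOn v (Icc m q) := by
    refine monotoneOn_of_deriv_nonneg (convex_Icc m q) (hc.mono (Icc_subset_Icc hm.1 hq.2))
      (fun t ht => ?_) (fun t ht => ?_)
    all_goals
      rw [interior_Icc] at ht
      have h := hv t (hsub t (Ioo_subset_Ico_self ht))
    · exact h.differentiableAt.differentiableWithinAt
    · rw [h.deriv, ← hdm]
      exact hmono' (left_mem_Ico.2 hmq) (Ioo_subset_Ico_self ht) ht.1.le
  have h1 := hmono (left_mem_Icc.2 hmq.le) (right_mem_Icc.2 hmq.le) hmq.le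
  have h2 : v q ≤ 0 := hvq
  linarith

/-- Comparison of two `AC²` functions: `x ≤ y` if `x ≤ y` at the endpoints, and `y'' ≤ x''` wherever
`y < x`. -/
lemma le_of_second_deriv_le {a b : ℝ} {x y x'' y'' : ℝ → ℝ} (hx : x ∈ AC2 a b) (hy : y ∈ AC2 a b)
    (hx'' : ∀ t ∈ Ioo a b, HasDerivAt (derivWithin x (Icc a b)) (x'' t) t)
    (hy'' : ∀ t ∈ Ioo a b, HasDerivAt (derivWithin y (Icc a b)) (y'' t) t)
    (hle : ∀ t ∈ Ioo a b, y t < x t → y'' t ≤ x'' t) (ha : x a ≤ y a) (hb : x b ≤ y b) :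
    ∀ t ∈ Icc a b, x t ≤ y t := fun t ht =>
  sub_nonpos.1 <| nonpos_of_convex_where_pos (v := fun t => x t - y t)
    (hx.1.continuousOn.sub hy.1.continuousOn)
    (fun _ ht => (AC2.hasDerivAt hx ht).sub (AC2.hasDerivAt hy ht))
    (fun _ ht => (hx'' _ ht).sub (hy'' _ ht))
    (fun _ ht h => sub_nonneg.2 (hle _ ht (sub_pos.1 h)))
    (sub_nonpos.2 ha) (sub_nonpos.2 hb) t ht

/-! ### Truncation of the nonlinearity -/

/-- The function `f`, extended from the region between `σl` and `σu` over `[a,b]` to the whole plane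
by projecting the first variable to `[a,b]`, then the second one to `[σl, σu]`. -/
noncomputable def truncate {a b : ℝ} (hab : a ≤ b) (σl σu : ℝ → ℝ) (f : ℝ → ℝ → ℝ) (t x : ℝ) : ℝ :=
  f (projIcc a b hab t) (max (σl (projIcc a b hab t)) (min (σu (projIcc a b hab t)) x))

lemma truncate_of_mem {a b t : ℝ} (hab : a ≤ b) (σl σu : ℝ → ℝ) (f : ℝ → ℝ → ℝ)
    (ht : t ∈ Icc a b) (x : ℝ) :
    truncate hab σl σu f t x = f t (max (σl t) (min (σu t) x)) := by
  simp [truncate, projIcc_of_mem hab ht]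

lemma continuous_truncate {a b : ℝ} (hab : a ≤ b) {σl σu : ℝ → ℝ} {f : ℝ → ℝ → ℝ}
    (hl : ContinuousOn σl (Icc a b)) (hu : ContinuousOn σu (Icc a b))
    (hlu : ∀ t ∈ Icc a b, σl t ≤ σu t)
    (hf : ContinuousOn (fun p : ℝ × ℝ => f p.1 p.2)
      {p : ℝ × ℝ | p.1 ∈ Icc a b ∧ σl p.1 ≤ p.2 ∧ p.2 ≤ σu p.1}) :
    Continuous (Function.uncurry (truncate hab σl σu f)) := by
  have hp : Continuous fun p : ℝ × ℝ => ((projIcc a b hab p.1 : Icc a b) : ℝ) :=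
    continuous_subtype_val.comp (continuous_projIcc.comp continuous_fst)
  have hl' := hl.comp_continuous hp fun p => (projIcc a b hab p.1).2
  have hu' := hu.comp_continuous hp fun p => (projIcc a b hab p.1).2
  exact hf.comp_continuous (hp.prodMk (hl'.max (hu'.min continuous_snd))) fun p =>
    ⟨(projIcc a b hab p.1).2, le_max_left _ _,
      max_le (hlu _ (projIcc a b hab p.1).2) (min_le_left _ _)⟩

/-- Values of the truncated function are attained on a compact rectangle. -/
lemma exists_bound_truncate {a b : ℝ} (hab : a ≤ b) {σl σu : ℝ → ℝ} {f : ℝ → ℝ → ℝ}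
    (hl : ContinuousOn σl (Icc a b)) (hu : ContinuousOn σu (Icc a b))
    (hlu : ∀ t ∈ Icc a b, σl t ≤ σu t)
    (hf : ContinuousOn (fun p : ℝ × ℝ => f p.1 p.2)
      {p : ℝ × ℝ | p.1 ∈ Icc a b ∧ σl p.1 ≤ p.2 ∧ p.2 ≤ σu p.1}) :
    ∃ M, ∀ t x, |truncate hab σl σu f t x| ≤ M := by
  obtain ⟨A, hA⟩ := isCompact_Icc.exists_bound_of_continuousOn hl
  obtain ⟨B, hB⟩ := isCompact_Icc.exists_bound_of_continuousOn hu
  obtain ⟨M, hM⟩ := (isCompact_Icc.prod isCompact_Icc).exists_bound_of_continuousOn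
    (s := Icc a b ×ˢ Icc (-A) B) (continuous_truncate hab hl hu hlu hf).continuousOn
  refine ⟨M, fun t x => ?_⟩
  set p : ℝ := (projIcc a b hab t).1
  have hp : p ∈ Icc a b := (projIcc a b hab t).2
  set y := max (σl p) (min (σu p) x)
  have hy : σl p ≤ y ∧ y ≤ σu p := ⟨le_max_left _ _, max_le (hlu p hp) (min_le_left _ _)⟩
  have heq : truncate hab σl σu f t x = truncate hab σl σu f p y := by
    rw [truncate_of_mem hab σl σu f hp, min_eq_right hy.2, max_eq_right hy.1]
    rfl
  rw [heq]
  exact hM (p, y) ⟨hp, by linarith [(abs_le.1 (hA p hp)).1], by linarith [(abs_le.1 (hB p hp)).2]⟩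

/-! ### Existence between a lower and an upper solution -/

theorem theorem1 (α a b : ℝ) (hα₁ : 1 < α) (hα₂ : α < 2) (hab : a < b)
    (f : ℝ → ℝ → ℝ) (σl σu : ℝ → ℝ)
    (hl : IsLowerSolution α a b f σl) (hu : IsUpperSolution α a b f σu)
    (hlu : ∀ t ∈ Icc a b, σl t ≤ σu t)
    (hf : ContinuousOn (fun p : ℝ × ℝ => f p.1 p.2)
      {p : ℝ × ℝ | p.1 ∈ Icc a b ∧ σl p.1 ≤ p.2 ∧ p.2 ≤ σu p.1}) :
    ∃ u ∈ AC2 a b, IsSolution α a b f u ∧ ∀ t ∈ Icc a b, σl t ≤ u t ∧ u t ≤ σu t := by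
  have hlc := hl.mem.1.continuousOn
  have huc := hu.mem.1.continuousOn
  set F := truncate hab.le σl σu f
  have hF : Continuous (Function.uncurry F) := continuous_truncate hab.le hlc huc hlu hf
  obtain ⟨M, hM⟩ : ∃ M, ∀ t x, |F t x| ≤ M := exists_bound_truncate hab.le hlc huc hlu hf
  -- integrability of the weight is where `1 < α` enters
  have hw : IntervalIntegrable (fun t => (t - a) ^ (α - 2)) MeasureTheory.volume a b := by
    simpa using (intervalIntegral.intervalIntegrable_rpow' (a := 0) (b := b - a)
      (by linarith : -1 < α - 2)).comp_sub_right a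
  obtain ⟨s, u, huC, hub, hint⟩ := exists_integral_solution hab hw hF hM
  have hi : IntervalIntegrable (fun t => (t - a) ^ (α - 2) * F t (u t)) MeasureTheory.volume a b :=
    intervalIntegrable_weight_mul hw hF huC
  have hcont : ContinuousOn (fun t => (t - a) ^ (α - 2) * F t (u t)) (Ioc a b) := by
    refine ContinuousOn.mul (ContinuousOn.rpow_const (by fun_prop) fun t ht => ?_)
      (hF.comp (continuous_id.prodMk huC)).continuousOn
    exact Or.inl (sub_pos.2 ht.1).ne'
  obtain ⟨huAC, hu''⟩ := regularity_of_integral_eq hab hi hcont hint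
  have hua : u a = 0 := by
    rw [hint a (left_mem_Icc.2 hab.le), integral_kernel_eq (left_mem_Icc.2 hab.le) hi hcont]
    simp
  have hFt : ∀ t ∈ Ioo a b, F t (u t) = f t (max (σl t) (min (σu t) (u t))) := fun t ht =>
    truncate_of_mem hab.le σl σu f (Ioo_subset_Icc_self ht) _
  have hwpos : ∀ t ∈ Ioo a b, 0 ≤ (t - a) ^ (α - 2) := fun t ht =>
    Real.rpow_nonneg (sub_nonneg.2 ht.1.le) _
  -- below `σl` or above `σu` the truncated nonlinearity is frozen, which decides the sign of the
  -- difference of the second derivatives there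
  have hle : ∀ t ∈ Icc a b, σl t ≤ u t := by
    choose! d hd hd' using fun t (ht : t ∈ Ioo a b) => hl.ineq t (Ioo_subset_Icc_self ht)
    refine le_of_second_deriv_le hl.mem huAC
      (fun t ht => ((hasConformableDeriv_iff ht).1 (hd t ht)).2) hu'' (fun t ht hlt => ?_)
      (hl.left.trans_eq hua.symm) (hl.right.trans_eq hub.symm)
    rw [hFt t ht, max_eq_left ((min_le_right _ _).trans hlt.le), ← mul_neg]
    exact mul_le_mul_of_nonneg_left (by linarith [hd' t ht]) (hwpos t ht)
  have hge : ∀ t ∈ Icc a b, u t ≤ σu t := by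
    choose! d hd hd' using fun t (ht : t ∈ Ioo a b) => hu.ineq t (Ioo_subset_Icc_self ht)
    refine le_of_second_deriv_le huAC hu.mem hu''
      (fun t ht => ((hasConformableDeriv_iff ht).1 (hd t ht)).2) (fun t ht hlt => ?_)
      (hua.trans_le hu.left) (hub.trans_le hu.right)
    rw [hFt t ht, min_eq_left hlt.le, max_eq_right (hlu t (Ioo_subset_Icc_self ht)), ← mul_neg]
    exact mul_le_mul_of_nonneg_left (by linarith [hd' t ht]) (hwpos t ht)
  refine ⟨u, huAC, ⟨fun t ht => ⟨-F t (u t), ?_, ?_⟩, hua, hub⟩, fun t ht => ⟨hle t ht, hge t ht⟩⟩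
  · rw [hasConformableDeriv_iff ht, mul_neg]
    exact ⟨huAC.1.differentiableOn one_ne_zero, hu'' t ht⟩
  · have ht' := Ioo_subset_Icc_self ht
    rw [hFt t ht, min_eq_right (hge t ht'), max_eq_right (hle t ht'), neg_add_cancel]
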